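/- Let $N\ge 1$ and consider the following causal bandit environment $\nu$ with parameters $p_1,\dots,p_N\in[0,1]$ and $\Delta>0$. There are $N$ independent variables $X_1,\dots,X_N$ with values in $\{1,2\}$ and $P(X_i=1)=p_i$, and the reward is $Y=\Delta X_1+\eta$, where $\eta\sim\mathcal N(0,1)$ is independent of the variables. The arms are the $3^N$ interventions $do(X_1=i_1,\dots,X_N=i_N)$ with $i_1,\dots,i_N\in\{0,1,2\}$, where $i_j=0$ means that $X_j$ is not set and keeps its marginal law. Let $\mu_a$ be the expected reward of the arm $a$. Standard (non-causal) UCB uses only the observed rewards: it pulls every arm once, and then in each round $t+1$ it pulls an arm $a$ that maximizes $\hat\mu_a(t)+\sqrt{2\log(1/\delta_t)/T_a(t)}$, with ties (also in the order of the initial pulls) broken in any way, where $T_a(t)$ is the number of pulls of $a$ in the first $t$ rounds and $\hat\mu_a(t)$ is the average of the rewards that these pulls gave. The confidence level is either $\delta_t=1/t$ (anytime version) or $\delta_t=1/T^2$ (version with known horizon $T$). Theorem. For every $\epsilon>0$ there is a constant $C_\epsilon>0$, depending only on $\epsilon$, such that for all $N\ge1$ and all $T\ge 3^N$ there is a $\Delta$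 with $0<\Delta\le 1/2$ (so that all $\mu_a$ lie in $[0,1]$) such that, for all $p_1,\dots,p_N\in[0,1]$ and for both versions of standard UCB, running it for $T$ steps in $\nu$ gives expected cumulative regret $$\mathbb E[R_T]=T\max_a\mu_a-\sum_{t=1}^T\mathbb E[\mu_{a_t}]\;\ge\; C_\epsilon\,\sqrt{3^N}\,T^{1/2-\epsilon}.$$ -/

import Mathlib

open MeasureTheory ProbabilityTheory

namespace CausalBandit

/-- The two values `1, 2` of a variable, encoded by `Fin 2` (index `0` is the value `1`,
index `1` is the value `2`). -/
noncomputable def value (v : Fin 2) : ℝ := (v.val : ℝ) + 1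

/-- The arms: interventions `do(X₁ = i₁, …, X_N = i_N)`. `none` means that the variable is not
set (the symbol `0`), `some v` that it is set to `v`. There are `3 ^ N` of them. -/
abbrev Intervention (N : ℕ) : Type := Fin N → Option (Fin 2)

/-- The law on `{1, 2}` that gives the value `1` probability `q`. -/
noncomputable def marginal (q : unitInterval) : Measure (Fin 2) :=
  ENNReal.ofReal (q : ℝ) • Measure.dirac 0 + ENNReal.ofReal (1 - (q : ℝ)) • Measure.dirac 1

/-- The law of one variable: its marginal if it is not intervened on, a point mass otherwise. -/
noncomputable def coordLaw (q : unitInterval) : Option (Fin 2) → Measure (Fin 2)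
  | none => marginal q
  | some v => Measure.dirac v

/-- The law of `(X₁, …, X_N)` under the intervention `a`, the variables being independent with
`P(X_i = 1) = p i` when nothing is set. -/
noncomputable def doLaw {N : ℕ} (p : Fin N → unitInterval) (a : Intervention N) :
    Measure (Fin N → Fin 2) :=
  Measure.pi fun i => coordLaw (p i) (a i)

/-- The law of the reward `Y = Δ X₁ + N(0, 1)` under the intervention `a`. The variable `X₁` is
the coordinate with index `0`; the noise is independent of the variables. -/
noncomputable def rewardLaw {N : ℕ} [NeZero N] (Δ : ℝ) (p : Fin N → unitInterval)
    (a : Intervention N) : Measure ℝ :=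
  ((doLaw p a).prod (gaussianReal 0 1)).map fun z => Δ * value (z.1 0) + z.2

/-- The expected reward `μ_a` of the arm `a`. -/
noncomputable def armMean {N : ℕ} [NeZero N] (Δ : ℝ) (p : Fin N → unitInterval)
    (a : Intervention N) : ℝ :=
  ∫ y, y ∂(rewardLaw Δ p a)

/-- The rewards of a multi-armed bandit whose arm `a` has reward law `law a`: `Y a n` is the
reward received when the arm `a` is pulled for the `(n + 1)`-st time; all of them are independent,
and those of the arm `a` have law `law a`. -/
structure IsRewardTable {K Ω : Type*} [MeasurableSpace Ω] (P : Measure Ω) (law : K → Measure ℝ)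
    (Y : K → ℕ → Ω → ℝ) : Prop where
  measurable : ∀ a n, Measurable (Y a n)
  map_eq : ∀ a n, P.map (Y a n) = law a
  indep : iIndepFun (fun i : K × ℕ => Y i.1 i.2) P

/-- The number of pulls of the arm `a` in the first `t` rounds, when `A s` is the arm pulled in
round `s + 1`. -/
def pulls {K : Type*} [DecidableEq K] (A : ℕ → K) (t : ℕ) (a : K) : ℕ :=
  ((Finset.range t).filter fun s => A s = a).card

/-- The empirical mean of the arm `a` after `t` rounds; `y a n` is the `(n + 1)`-st reward that
the arm `a` yields. -/
noncomputable def empMean {K : Type*} [DecidableEq K] (y : K → ℕ → ℝ) (A : ℕ → K) (t : ℕ)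
    (a : K) : ℝ :=
  (∑ n ∈ Finset.range (pulls A t a), y a n) / (pulls A t a : ℝ)

/-- The upper confidence bound of the arm `a` after `t` rounds at confidence level `δ`: the
empirical mean plus `√(2 log (1/δ) / (number of pulls))`, and `+∞` for an arm that has not been
pulled yet (so that every arm is pulled once first). -/
noncomputable def ucbIndex {K : Type*} [DecidableEq K] (δ : ℝ) (y : K → ℕ → ℝ) (A : ℕ → K)
    (t : ℕ) (a : K) : EReal :=
  if pulls A t a = 0 then ⊤
  else ((empMean y A t a + Real.sqrt (2 * Real.log (1 / δ) / (pulls A t a : ℝ)) : ℝ) : EReal)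

/-- The two usual choices of the confidence level in the UCB algorithm. -/
inductive UCBVersion : Type
  | anytime
  | fixedHorizon

/-- The confidence level used after `t` completed rounds out of `T`: `1 / t` in the anytime
version (with the bonus `√(2 log t / n)`), and `1 / T ^ 2` in the fixed-horizon version (with the
bonus `√(4 log T / n)`). -/
noncomputable def UCBVersion.level : UCBVersion → ℕ → ℕ → ℝ
  | .anytime, _, t => 1 / (t : ℝ)
  | .fixedHorizon, T, _ => 1 / (T : ℝ) ^ 2

/-- The sequence of arms `A` is a run of UCB for `T` rounds on the rewards `y`: in each round an
arm with the largest upper confidence bound is pulled (ties are broken in any way). -/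
def IsUCBRun {K : Type*} [DecidableEq K] (v : UCBVersion) (T : ℕ) (y : K → ℕ → ℝ)
    (A : ℕ → K) : Prop :=
  ∀ t < T, ∀ b, ucbIndex (v.level T t) y A t b ≤ ucbIndex (v.level T t) y A t (A t)

/-- The expected cumulative regret `T μ* - ∑_{t ≤ T} E[μ_{a_t}]`. -/
noncomputable def expectedRegret {K Ω : Type*} [MeasurableSpace Ω] (P : Measure Ω) (mean : K → ℝ)
    (A : ℕ → Ω → K) (T : ℕ) : ℝ :=
  (T : ℝ) * (⨆ a, mean a) - ∑ t ∈ Finset.range T, ∫ ω, mean (A t ω) ∂P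

end CausalBandit

namespace CausalBandit

/-! ### Deterministic analysis of a UCB run: pull counts and indices -/

section Pulls

variable {K : Type*} [DecidableEq K]

/-! Write K = 3^N and take Δ = √(K/T)/2. A third of the arms set X₁ = 1 and have gap Δ. If every arm
gets T^(1-ε)/K pulls with probability at least 1/2, the regret is at least Δ T^(1-ε)/6, which is √K
T^(1/2-ε)/12.

The mechanism is over-exploration (`IsUCBRun.lt_pulls`). By pigeonhole, some arm pulled in the
second half of the run already has n₀ = T/(4K) pulls. Unless it was very lucky, its index is at most
four times a bonus at n₀ pulls, because even the best mean 2Δ is of order 1/√n₀. An arm with n pulls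
keeps an index above κ times its own bonus unless its empirical mean drops to -(1-κ) bonuses. So an
arm with n ≤ κ²n₀/16 would have won that round.

The loss of ε comes from the union bound in `half_le_measureReal_lt_pulls`: one unlucky deviation
has probability about T^(-(1-κ)²), and there are up to T^(1-ε) pairs of an arm and a count, so κ =
ε/4 suffices. When T is too small for this, the initial pull of every arm already gives the bound
(`initial_le_expectedRegret`). -/

theorem pulls_mono (A : ℕ → K) (a : K) : Monotone fun t => pulls A t a := by
  intro s t h
  exact Finset.card_le_card (Finset.filter_subset_filter _ (Finset.range_mono h))

theorem pulls_succ_self (A : ℕ → K) (t : ℕ) : pulls A (t + 1) (A t) = pulls A t (A t) + 1 := by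
  simp [pulls, Finset.range_add_one, Finset.filter_insert]

theorem pulls_le (A : ℕ → K) (t : ℕ) (a : K) : pulls A t a ≤ t := by
  simpa [pulls] using Finset.card_filter_le (Finset.range t) (fun s => A s = a)

theorem pulls_lt_pulls (A : ℕ → K) {s t : ℕ} (h : s < t) :
    pulls A s (A s) < pulls A t (A s) := by
  have := pulls_mono A (A s) (show s + 1 ≤ t from h)
  simp only [pulls_succ_self] at this
  omega

/-- In a window that is longer than `card K * q`, some arm is pulled that already has at least
`q` pulls. -/
theorem exists_le_pulls_of_card_mul_lt [Fintype K] (A : ℕ → K) {s T q : ℕ}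
    (h : Fintype.card K * q < T - s) :
    ∃ t, s ≤ t ∧ t < T ∧ q ≤ pulls A t (A t) := by
  by_contra! hcon
  -- A round is determined by its arm together with the count of that arm before the pull, since
  -- each pull raises the count.
  have hcard : (Finset.Ico s T).card ≤ ((Finset.univ : Finset K) ×ˢ Finset.range q).card := by
    refine Finset.card_le_card_of_injOn (fun t => (A t, pulls A t (A t))) ?_ ?_
    · intro t ht
      have ht' := Finset.mem_Ico.1 (Finset.mem_coe.1 ht)
      simpa using hcon t ht'.1 ht'.2
    · intro t _ t' _ he
      simp only [Prod.mk.injEq] at he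
      obtain ⟨h1, h2⟩ := he
      rcases lt_trichotomy t t' with hlt | heq | hlt
      · have := pulls_lt_pulls A hlt
        rw [h2, h1] at this
        exact absurd this (lt_irrefl _)
      · exact heq
      · have := pulls_lt_pulls A hlt
        rw [← h2, ← h1] at this
        exact absurd this (lt_irrefl _)
  simp only [Nat.card_Ico, Finset.card_product, Finset.card_univ, Finset.card_range] at hcard
  omega

/-- UCB pulls every arm during the first `card K` rounds. -/
theorem IsUCBRun.one_le_pulls [Fintype K] {v : UCBVersion} {T : ℕ} {y : K → ℕ → ℝ} {A : ℕ → K}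
    (hrun : IsUCBRun v T y A) (hT : Fintype.card K ≤ T) (b : K) : 1 ≤ pulls A T b := by
  by_contra! hb
  have hb0 : pulls A T b = 0 := by omega
  -- While `b` has index `⊤`, only fresh arms can be pulled; the T rounds then inject into the arms
  -- other than `b`, which are too few.
  have hzero : ∀ t < T, pulls A t (A t) = 0 := by
    intro t ht
    by_contra hne
    have h1 : pulls A t b = 0 := by
      have := pulls_mono A b ht.le
      simp only at this
      omega
    have h2 := hrun t ht b
    rw [ucbIndex, ucbIndex, if_pos h1, if_neg hne, top_le_iff] at h2
    exact EReal.coe_ne_top _ h2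
  have hcard : (Finset.range T).card ≤ (Finset.univ.erase b : Finset K).card := by
    refine Finset.card_le_card_of_injOn A ?_ ?_
    · intro t ht
      have ht' : t < T := by simpa using ht
      simp only [Finset.coe_erase, Finset.coe_univ, Set.mem_sdiff, Set.mem_univ, true_and,
        Set.mem_singleton_iff]
      intro he
      have h1 := pulls_lt_pulls A ht'
      rw [he, hb0] at h1
      omega
    · intro t ht t' ht' he
      have h1 := hzero t (by simpa using ht)
      have h2 := hzero t' (by simpa using ht')
      rcases lt_trichotomy t t' with hlt | heq | hlt
      · have := pulls_lt_pulls A hlt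
        rw [he, h2] at this
        omega
      · exact heq
      · have := pulls_lt_pulls A hlt
        rw [← he, h1] at this
        omega
  have hpos : 0 < Fintype.card K := Fintype.card_pos_iff.2 ⟨b⟩
  rw [Finset.card_range, Finset.card_erase_of_mem (Finset.mem_univ b), Finset.card_univ] at hcard
  omega

/-- The only fact about the confidence levels that the argument needs; it treats both versions at
once. -/
theorem log_half_le_log_level (v : UCBVersion) {T t : ℕ} (hT : 1 ≤ T) (ht : (T : ℝ) / 2 ≤ t) :
    Real.log ((T : ℝ) / 2) ≤ Real.log (1 / v.level T t) := by
  have hT' : (1 : ℝ) ≤ T := by exact_mod_cast hT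
  apply Real.log_le_log (by positivity)
  cases v with
  | anytime => simpa [UCBVersion.level] using ht
  | fixedHorizon =>
    simp only [UCBVersion.level, one_div_one_div]
    nlinarith

/-- If no arm is unlucky during its first `m` pulls and no arm is very lucky, then UCB pulls
every arm more than `m` times. -/
theorem IsUCBRun.lt_pulls [Fintype K] {v : UCBVersion} {T : ℕ} {y : K → ℕ → ℝ} {A : ℕ → K}
    (hrun : IsUCBRun v T y A) {κ D m n₀ : ℝ} (hκ : 0 < κ) (hκ1 : κ ≤ 1) (hn₀ : 0 < n₀)
    (hD : D * Real.sqrt n₀ ≤ 1) (hm : 16 * m ≤ κ ^ 2 * n₀)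
    (hlog : 1 / 2 ≤ Real.log ((T : ℝ) / 2))
    (hT : (Fintype.card K : ℝ) * (n₀ + 1) < (T - 1) / 2)
    (hlow : ∀ (a : K) (n : ℕ), 1 ≤ n → (n : ℝ) ≤ m →
      -((1 - κ) * Real.sqrt (2 * Real.log ((T : ℝ) / 2)) * Real.sqrt n) <
        ∑ i ∈ Finset.range n, y a i)
    (hup : ∀ (a : K) (n : ℕ), 1 ≤ n → n ≤ T →
      ∑ i ∈ Finset.range n, y a i <
        D * n + 2 * Real.sqrt (2 * Real.log ((T : ℝ) / 2)) * Real.sqrt n) (b : K) :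
    m < pulls A T b := by
  by_contra! hb
  have hKpos : 0 < Fintype.card K := Fintype.card_pos_iff.2 ⟨b⟩
  -- The window starts at T/2 rounded up, so that t ≥ T/2 holds in it and `log_half_le_log_level`
  -- applies.
  have hq : Fintype.card K * ⌈n₀⌉₊ < T - (T + 1) / 2 := by
    have h1 : (⌈n₀⌉₊ : ℝ) < n₀ + 1 := Nat.ceil_lt_add_one hn₀.le
    have h2 : ((Fintype.card K * ⌈n₀⌉₊ : ℕ) : ℝ) < (T - 1) / 2 := by
      push_cast
      refine lt_of_le_of_lt ?_ hT
      gcongr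
    have h3 : ((2 * (Fintype.card K * ⌈n₀⌉₊) + 1 : ℕ) : ℝ) < (T : ℝ) := by
      push_cast at h2 ⊢
      linarith
    have h4 : 2 * (Fintype.card K * ⌈n₀⌉₊) + 1 < T := by exact_mod_cast h3
    omega
  obtain ⟨t, hst, htT, hqt⟩ := exists_le_pulls_of_card_mul_lt A hq
  have hng : n₀ ≤ (pulls A t (A t) : ℝ) := (Nat.le_ceil n₀).trans (by exact_mod_cast hqt)
  have hng1 : 1 ≤ pulls A t (A t) := by
    have : (0 : ℝ) < pulls A t (A t) := hn₀.trans_le hng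
    exact_mod_cast this
  have hidx := hrun t htT b
  have hnb1 : 1 ≤ pulls A t b := by
    by_contra hlt
    have h0 : pulls A t b = 0 := by omega
    have hne : pulls A t (A t) ≠ 0 := by omega
    rw [ucbIndex, ucbIndex, if_pos h0, if_neg hne, top_le_iff] at hidx
    exact EReal.coe_ne_top _ hidx
  have hnbm : (pulls A t b : ℝ) ≤ m := by
    have : pulls A t b ≤ pulls A T b := pulls_mono A b htT.le
    exact le_trans (by exact_mod_cast this) hb
  have ht2 : (T : ℝ) / 2 ≤ t := by
    have h1 : T ≤ 2 * t := by omega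
    have h2 : (T : ℝ) ≤ 2 * t := by exact_mod_cast h1
    linarith
  have hL := log_half_le_log_level v (T := T) (t := t) (by omega) ht2
  have hlow' := hlow b _ hnb1 hnbm
  have hup' := hup (A t) _ hng1 ((pulls_le A t (A t)).trans htT.le)
  rw [ucbIndex, ucbIndex, if_neg (by omega), if_neg (by omega), EReal.coe_le_coe_iff,
    empMean, empMean] at hidx
  set nb : ℝ := (pulls A t b : ℝ)
  set ng : ℝ := (pulls A t (A t) : ℝ)
  set L := Real.log (1 / v.level T t)
  set ℓ := Real.log ((T : ℝ) / 2)
  set Sb := ∑ i ∈ Finset.range (pulls A t b), y b i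
  set Sg := ∑ i ∈ Finset.range (pulls A t (A t)), y (A t) i
  have hnb : 0 < nb := Nat.cast_pos.2 hnb1
  have hngp : 0 < ng := hn₀.trans_le hng
  rw [Real.sqrt_div' _ hnb.le, Real.sqrt_div' _ hngp.le] at hidx
  have hr : Real.sqrt (2 * ℓ) ≤ Real.sqrt (2 * L) := Real.sqrt_le_sqrt (by linarith)
  -- This lets the mean `D`, at most 1/√n₀, be absorbed into one bonus r/√n₀ below.
  have hr1 : 1 ≤ Real.sqrt (2 * ℓ) := Real.one_le_sqrt.2 (by linarith)
  set r := Real.sqrt (2 * L)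
  set ρ := Real.sqrt (2 * ℓ)
  have hsb : 0 < Real.sqrt nb := Real.sqrt_pos.2 hnb
  have hsg : 0 < Real.sqrt ng := Real.sqrt_pos.2 hngp
  have hs0 : 0 < Real.sqrt n₀ := Real.sqrt_pos.2 hn₀
  have hsnb : Real.sqrt nb * Real.sqrt nb = nb := Real.mul_self_sqrt hnb.le
  have hsng : Real.sqrt ng * Real.sqrt ng = ng := Real.mul_self_sqrt hngp.le
  -- Deviations are measured with ρ and bonuses with r ≥ ρ, so a fraction κ of the bonus survives.
  have h1 : κ * r / Real.sqrt nb < Sb / nb + r / Real.sqrt nb := by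
    have e1 : -((1 - κ) * ρ) / Real.sqrt nb < Sb / nb := by
      rw [div_lt_div_iff₀ hsb hnb]
      have := mul_lt_mul_of_pos_right hlow' hsb
      calc -((1 - κ) * ρ) * nb = -((1 - κ) * ρ * Real.sqrt nb) * Real.sqrt nb := by
            rw [← hsnb]; ring_nf; simp
        _ < _ := this
    have e2 : κ * r / Real.sqrt nb ≤ -((1 - κ) * ρ) / Real.sqrt nb + r / Real.sqrt nb := by
      rw [← add_div]
      gcongr
      nlinarith
    linarith
  have h2 : Sg / ng + r / Real.sqrt ng < D + 3 * r / Real.sqrt ng := by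
    have e1 : Sg / ng < D + 2 * ρ / Real.sqrt ng := by
      rw [div_lt_iff₀ hngp]
      calc Sg < D * ng + 2 * ρ * Real.sqrt ng := hup'
        _ = (D + 2 * ρ / Real.sqrt ng) * ng := by
            rw [add_mul]
            congr 1
            rw [div_mul_eq_mul_div, eq_div_iff hsg.ne', mul_assoc, hsng]
    have e2 : 2 * ρ / Real.sqrt ng ≤ 2 * r / Real.sqrt ng := by gcongr
    have e3 : 2 * r / Real.sqrt ng + r / Real.sqrt ng = 3 * r / Real.sqrt ng := by ring
    linarith
  have h3 : D + 3 * r / Real.sqrt ng ≤ 4 * r / Real.sqrt n₀ := by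
    have e1 : D ≤ r / Real.sqrt n₀ := by
      rw [le_div_iff₀ hs0]
      linarith
    have e2 : 3 * r / Real.sqrt ng ≤ 3 * r / Real.sqrt n₀ := by gcongr
    have e3 : r / Real.sqrt n₀ + 3 * r / Real.sqrt n₀ = 4 * r / Real.sqrt n₀ := by ring
    linarith
  have h4 : 4 * r / Real.sqrt n₀ ≤ κ * r / Real.sqrt nb := by
    rw [div_le_div_iff₀ hs0 hsb]
    have : 4 * Real.sqrt nb ≤ κ * Real.sqrt n₀ := by
      apply le_of_sq_le_sq _ (by positivity)
      rw [mul_pow, mul_pow, Real.sq_sqrt hnb.le, Real.sq_sqrt hn₀.le]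
      linarith
    nlinarith
  linarith

end Pulls

/-! ### Deviation bounds and the probability that every arm is pulled often -/

section Tail

variable {Ω : Type*} [MeasurableSpace Ω] {P : Measure Ω}

/-- Chernoff's bound for sums of independent variables with a one-sided sub-Gaussian moment
generating function. -/
theorem measureReal_sqrt_le_sum_le [IsProbabilityMeasure P] {X : ℕ → Ω → ℝ}
    (hX : ∀ i, Measurable (X i)) (hind : iIndepFun X P)
    (hint : ∀ i s, 0 ≤ s → Integrable (fun ω => Real.exp (s * X i ω)) P)
    (hmgf : ∀ i s, 0 ≤ s → mgf (X i) P s ≤ Real.exp (s ^ 2 / 2))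
    {n : ℕ} (hn : 1 ≤ n) {c : ℝ} (hc : 0 ≤ c) :
    P.real {ω | c * Real.sqrt n ≤ ∑ i ∈ Finset.range n, X i ω} ≤ Real.exp (-c ^ 2 / 2) := by
  have hn0 : (0 : ℝ) < n := by exact_mod_cast hn
  have hsq : 0 < Real.sqrt n := Real.sqrt_pos.2 hn0
  -- The minimizer of the Chernoff exponent -s c√n + n s²/2.
  set s := c / Real.sqrt n with hs
  have hs0 : 0 ≤ s := by positivity
  have h1 := measure_ge_le_exp_mul_mgf (μ := P) (X := ∑ i ∈ Finset.range n, X i)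
    (c * Real.sqrt n) hs0 (hind.integrable_exp_mul_sum hX fun i _ => hint i s hs0)
  simp only [Finset.sum_apply] at h1
  refine h1.trans ?_
  rw [hind.mgf_sum hX]
  have h2 : ∏ i ∈ Finset.range n, mgf (X i) P s ≤ Real.exp (s ^ 2 / 2) ^ n := by
    calc _ ≤ ∏ _i ∈ Finset.range n, Real.exp (s ^ 2 / 2) :=
          Finset.prod_le_prod (fun i _ => mgf_nonneg) fun i _ => hmgf i s hs0
      _ = _ := by simp
  calc _ ≤ Real.exp (-s * (c * Real.sqrt n)) * Real.exp (s ^ 2 / 2) ^ n := by gcongr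
    _ = Real.exp (-c ^ 2 / 2) := by
      rw [← Real.exp_nat_mul, ← Real.exp_add]
      congr 1
      have h3 : s * Real.sqrt n = c := by rw [hs]; field_simp
      have h4 : (n : ℝ) = Real.sqrt n * Real.sqrt n := (Real.mul_self_sqrt hn0.le).symm
      have h5 : (n : ℝ) * s ^ 2 = c ^ 2 := by rw [← h3, mul_pow, Real.sq_sqrt hn0.le]; ring
      have h6 : s * (c * Real.sqrt n) = c ^ 2 := by rw [mul_left_comm, h3]; ring
      linear_combination h5 / 2 - h6

/-- A law that is sub-Gaussian with variance proxy `1` to the right of `D` and to the left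
of `0`. -/
structure IsSubGaussianBetween (D : ℝ) (μ : Measure ℝ) : Prop where
  integrable : ∀ s, Integrable (fun y => Real.exp (s * y)) μ
  upper : ∀ s, 0 ≤ s → ∫ y, Real.exp (s * y) ∂μ ≤ Real.exp (s * D + s ^ 2 / 2)
  lower : ∀ s, 0 ≤ s → ∫ y, Real.exp (-s * y) ∂μ ≤ Real.exp (s ^ 2 / 2)

variable {K : Type*} {law : K → Measure ℝ} {Y : K → ℕ → Ω → ℝ} {D : ℝ}

theorem IsRewardTable.iIndepFun_arm (hY : IsRewardTable P law Y) (a : K) :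
    iIndepFun (fun n => Y a n) P :=
  hY.indep.precomp (g := fun n : ℕ => (a, n)) (fun _ _ h => (Prod.mk.inj h).2)

theorem IsRewardTable.integrable_exp (hY : IsRewardTable P law Y)
    (hlaw : ∀ a, IsSubGaussianBetween D (law a)) (a : K) (n : ℕ) (s : ℝ) :
    Integrable (fun ω => Real.exp (s * Y a n ω)) P := by
  have h := (hlaw a).integrable s
  rw [← hY.map_eq a n] at h
  exact h.comp_measurable (hY.measurable a n)

theorem IsRewardTable.integral_exp (hY : IsRewardTable P law Y) (a : K) (n : ℕ) (s : ℝ) :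
    ∫ ω, Real.exp (s * Y a n ω) ∂P = ∫ y, Real.exp (s * y) ∂(law a) := by
  rw [← hY.map_eq a n, integral_map (hY.measurable a n).aemeasurable (by fun_prop)]

theorem IsRewardTable.measureReal_upper_le [IsProbabilityMeasure P] (hY : IsRewardTable P law Y)
    (hlaw : ∀ a, IsSubGaussianBetween D (law a)) (a : K) {n : ℕ} (hn : 1 ≤ n) {c : ℝ}
    (hc : 0 ≤ c) :
    P.real {ω | D * n + c * Real.sqrt n ≤ ∑ i ∈ Finset.range n, Y a i ω} ≤
      Real.exp (-c ^ 2 / 2) := by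
  have hexp : ∀ (s : ℝ) (i : ℕ) (ω : Ω), Real.exp (s * (Y a i ω - D)) =
      Real.exp (-(s * D)) * Real.exp (s * Y a i ω) := by
    intro s i ω
    rw [← Real.exp_add]
    ring_nf
  have h := measureReal_sqrt_le_sum_le (P := P) (X := fun i ω => Y a i ω - D)
    (fun i => (hY.measurable a i).sub_const D)
    ((hY.iIndepFun_arm a).comp (fun _ y => y - D) fun _ => by fun_prop)
    (fun i s _ => by
      simp only [hexp]
      exact (hY.integrable_exp hlaw a i s).const_mul _)
    (fun i s hs => by
      simp only [mgf, hexp]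
      rw [integral_const_mul, hY.integral_exp]
      calc _ ≤ Real.exp (-(s * D)) * Real.exp (s * D + s ^ 2 / 2) := by
            gcongr
            exact (hlaw a).upper s hs
        _ = _ := by rw [← Real.exp_add]; ring_nf) hn hc
  convert h using 4
  rw [Finset.sum_sub_distrib, Finset.sum_const, Finset.card_range, nsmul_eq_mul, le_sub_iff_add_le]
  ring_nf

theorem IsRewardTable.measureReal_lower_le [IsProbabilityMeasure P] (hY : IsRewardTable P law Y)
    (hlaw : ∀ a, IsSubGaussianBetween D (law a)) (a : K) {n : ℕ} (hn : 1 ≤ n) {c : ℝ}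
    (hc : 0 ≤ c) :
    P.real {ω | ∑ i ∈ Finset.range n, Y a i ω ≤ -(c * Real.sqrt n)} ≤
      Real.exp (-c ^ 2 / 2) := by
  have hexp : ∀ (s : ℝ) (i : ℕ) (ω : Ω), Real.exp (s * -Y a i ω) = Real.exp (-s * Y a i ω) := by
    intro s i ω
    ring_nf
  have h := measureReal_sqrt_le_sum_le (P := P) (X := fun i ω => -Y a i ω)
    (fun i => (hY.measurable a i).neg)
    ((hY.iIndepFun_arm a).comp (fun _ y => -y) fun _ => by fun_prop)
    (fun i s _ => by
      simp only [hexp]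
      exact hY.integrable_exp hlaw a i (-s))
    (fun i s hs => by
      simp only [mgf, hexp]
      rw [hY.integral_exp]
      exact (hlaw a).lower s hs) hn hc
  convert h using 4
  rw [Finset.sum_neg_distrib, le_neg]

/-- With probability at least one half, UCB pulls every arm more than `m` times, if the union
bounds over the deviations of the empirical means are summable to at most one half. -/
theorem half_le_measureReal_lt_pulls [IsProbabilityMeasure P] [Fintype K] [DecidableEq K]
    (hY : IsRewardTable P law Y) (hlaw : ∀ a, IsSubGaussianBetween D (law a))
    {v : UCBVersion} {T : ℕ} {A : ℕ → Ω → K}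
    (hrun : ∀ᵐ ω ∂P, IsUCBRun v T (fun a n => Y a n ω) (fun t => A t ω))
    {κ m n₀ : ℝ} (hκ : 0 < κ) (hκ1 : κ ≤ 1) (hm0 : 0 ≤ m) (hn₀ : 0 < n₀)
    (hD : D * Real.sqrt n₀ ≤ 1) (hm : 16 * m ≤ κ ^ 2 * n₀)
    (hlog : 1 / 2 ≤ Real.log ((T : ℝ) / 2))
    (hT : (Fintype.card K : ℝ) * (n₀ + 1) < (T - 1) / 2)
    (hlow : Fintype.card K * m * Real.exp (-(1 - κ) ^ 2 * Real.log ((T : ℝ) / 2)) ≤ 1 / 4)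
    (hup : Fintype.card K * T * Real.exp (-4 * Real.log ((T : ℝ) / 2)) ≤ 1 / 4) :
    1 / 2 ≤ P.real {ω | ∀ b, m < pulls (fun t => A t ω) T b} := by
  set ℓ := Real.log ((T : ℝ) / 2)
  set ρ := Real.sqrt (2 * ℓ)
  have hρ : ρ ^ 2 = 2 * ℓ := Real.sq_sqrt (by linarith)
  have hρ0 : 0 ≤ ρ := Real.sqrt_nonneg _
  set B₀ : Set Ω := {ω | ¬ IsUCBRun v T (fun a n => Y a n ω) (fun t => A t ω)}
  have hB₀ : P.real B₀ = 0 := by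
    rw [measureReal_def, show P B₀ = 0 from hrun]
    rfl
  set B₁ : Set Ω := ⋃ i ∈ (Finset.univ : Finset K) ×ˢ Finset.Icc 1 ⌊m⌋₊,
    {ω | ∑ j ∈ Finset.range i.2, Y i.1 j ω ≤ -((1 - κ) * ρ * Real.sqrt i.2)}
  have hB₁ : P.real B₁ ≤ 1 / 4 := by
    refine (measureReal_biUnion_finset_le _ _).trans ?_
    calc _ ≤ ∑ _i ∈ (Finset.univ : Finset K) ×ˢ Finset.Icc 1 ⌊m⌋₊,
          Real.exp (-(1 - κ) ^ 2 * ℓ) := by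
          refine Finset.sum_le_sum fun i hi => ?_
          have hi1 := (Finset.mem_Icc.1 (Finset.mem_product.1 hi).2).1
          refine (hY.measureReal_lower_le hlaw i.1 hi1
            (mul_nonneg (by linarith) hρ0)).trans_eq ?_
          congr 1
          rw [mul_pow, hρ]
          ring
      _ = Fintype.card K * (⌊m⌋₊ : ℝ) * Real.exp (-(1 - κ) ^ 2 * ℓ) := by
          simp
      _ ≤ Fintype.card K * m * Real.exp (-(1 - κ) ^ 2 * ℓ) := by
          gcongr
          exact Nat.floor_le hm0
      _ ≤ 1 / 4 := hlow
  set B₂ : Set Ω := ⋃ i ∈ (Finset.univ : Finset K) ×ˢ Finset.Icc 1 T,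
    {ω | D * i.2 + 2 * ρ * Real.sqrt i.2 ≤ ∑ j ∈ Finset.range i.2, Y i.1 j ω}
  have hB₂ : P.real B₂ ≤ 1 / 4 := by
    refine (measureReal_biUnion_finset_le _ _).trans ?_
    calc _ ≤ ∑ _i ∈ (Finset.univ : Finset K) ×ˢ Finset.Icc 1 T, Real.exp (-4 * ℓ) := by
          refine Finset.sum_le_sum fun i hi => ?_
          have hi1 := (Finset.mem_Icc.1 (Finset.mem_product.1 hi).2).1
          refine (hY.measureReal_upper_le hlaw i.1 hi1 (by positivity)).trans_eq ?_
          congr 1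
          rw [mul_pow, hρ]
          ring
      _ = Fintype.card K * (T : ℝ) * Real.exp (-4 * ℓ) := by
          simp
      _ ≤ 1 / 4 := hup
  set G : Set Ω := {ω | ∀ b, m < pulls (fun t => A t ω) T b}
  -- Only monotonicity and subadditivity of `P` are used, so these events need not be shown
  -- measurable.
  have hcover : (Set.univ : Set Ω) ⊆ G ∪ (B₀ ∪ (B₁ ∪ B₂)) := by
    intro ω _
    by_contra hω
    simp only [Set.mem_union, not_or] at hω
    obtain ⟨hG, h0, h1, h2⟩ := hω
    refine hG (IsUCBRun.lt_pulls (not_not.1 h0) hκ hκ1 hn₀ hD hm hlog hT ?_ ?_)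
    · intro a n hn1 hnm
      by_contra! hcon
      refine h1 (Set.mem_biUnion (x := (a, n)) ?_ hcon)
      simpa using ⟨hn1, Nat.le_floor hnm⟩
    · intro a n hn1 hnT
      by_contra! hcon
      refine h2 (Set.mem_biUnion (x := (a, n)) ?_ hcon)
      simpa using ⟨hn1, hnT⟩
  have h1 : P.real Set.univ = 1 := probReal_univ
  have h2 := measureReal_mono (μ := P) hcover
  have h3 := measureReal_union_le (μ := P) G (B₀ ∪ (B₁ ∪ B₂))
  have h4 := measureReal_union_le (μ := P) B₀ (B₁ ∪ B₂)
  have h5 := measureReal_union_le (μ := P) B₁ B₂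
  linarith

end Tail

/-! ### Reward laws, arm means and the number of arms with a given first coordinate -/

section Law

instance (q : unitInterval) : IsProbabilityMeasure (marginal q) := by
  constructor
  have h1 : (0 : ℝ) ≤ 1 - q := sub_nonneg.2 q.2.2
  simp only [marginal, Measure.coe_add, Measure.coe_smul, Pi.add_apply, Pi.smul_apply,
    measure_univ, smul_eq_mul, mul_one]
  rw [← ENNReal.ofReal_add q.2.1 h1]
  simp

instance (q : unitInterval) (o : Option (Fin 2)) : IsProbabilityMeasure (coordLaw q o) := by
  cases o <;> (simp only [coordLaw]; infer_instance)

variable {N : ℕ}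

instance (p : Fin N → unitInterval) (a : Intervention N) : IsProbabilityMeasure (doLaw p a) := by
  unfold doLaw
  infer_instance

variable [NeZero N]

theorem one_le_value (v : Fin 2) : 1 ≤ value v := by
  simp [value]

theorem value_le_two (v : Fin 2) : value v ≤ 2 := by
  have h : v.val ≤ 1 := by omega
  have h' : (v.val : ℝ) ≤ 1 := by exact_mod_cast h
  simp only [value]
  linarith

theorem measurable_value_eval : Measurable fun z : Fin N → Fin 2 => value (z 0) :=
  (measurable_of_finite value).comp (measurable_pi_apply 0)

theorem integrable_value_eval (p : Fin N → unitInterval) (a : Intervention N) :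
    Integrable (fun z : Fin N → Fin 2 => value (z 0)) (doLaw p a) :=
  Integrable.of_finite

theorem measurable_reward (Δ : ℝ) :
    Measurable fun z : (Fin N → Fin 2) × ℝ => Δ * value (z.1 0) + z.2 :=
  ((measurable_value_eval.comp measurable_fst).const_mul Δ).add measurable_snd

theorem armMean_eq (Δ : ℝ) (p : Fin N → unitInterval) (a : Intervention N) :
    armMean Δ p a = Δ * ∫ z, value (z 0) ∂(doLaw p a) := by
  rw [armMean, rewardLaw, integral_map (measurable_reward Δ).aemeasurable (by fun_prop)]
  have h1 : Integrable (fun z : (Fin N → Fin 2) × ℝ => Δ * value (z.1 0))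
      ((doLaw p a).prod (gaussianReal 0 1)) :=
    ((integrable_value_eval p a).const_mul Δ).comp_fst _
  have h2 : Integrable (fun z : (Fin N → Fin 2) × ℝ => z.2)
      ((doLaw p a).prod (gaussianReal 0 1)) :=
    (memLp_id_gaussianReal 1 |>.integrable le_rfl).comp_snd _
  rw [integral_add h1 h2, integral_fun_fst (fun z : Fin N → Fin 2 => Δ * value (z 0)),
    integral_fun_snd (fun x : ℝ => x), integral_const_mul]
  simp

theorem armMean_le_two_mul {Δ : ℝ} (hΔ : 0 ≤ Δ) (p : Fin N → unitInterval)
    (a : Intervention N) : armMean Δ p a ≤ 2 * Δ := by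
  rw [armMean_eq, mul_comm]
  gcongr
  calc _ ≤ ∫ _z, (2 : ℝ) ∂(doLaw p a) :=
        integral_mono (integrable_value_eval p a) (integrable_const _) fun z => value_le_two _
    _ = 2 := by simp

theorem armMean_of_eq_some (Δ : ℝ) (p : Fin N → unitInterval) {a : Intervention N} {v : Fin 2}
    (ha : a 0 = some v) : armMean Δ p a = Δ * value v := by
  rw [armMean_eq]
  congr 1
  have h := (measurePreserving_eval (fun i => coordLaw (p i) (a i)) 0).map_eq
  have h2 : ∫ z, value (z 0) ∂(doLaw p a) = ∫ x, value x ∂(coordLaw (p 0) (a 0)) := by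
    rw [← h, integral_map (measurable_pi_apply 0).aemeasurable
      (measurable_of_finite value).aestronglyMeasurable]
    rfl
  rw [h2, ha]
  simp [coordLaw]

theorem iSup_armMean {Δ : ℝ} (hΔ : 0 ≤ Δ) (p : Fin N → unitInterval) :
    ⨆ a, armMean Δ p a = 2 * Δ := by
  refine le_antisymm (ciSup_le fun a => armMean_le_two_mul hΔ p a) ?_
  have h := armMean_of_eq_some Δ p (a := fun _ => some 1) rfl
  rw [show 2 * Δ = Δ * value 1 by norm_num [value]; ring, ← h]
  exact le_ciSup (f := armMean Δ p) (Set.finite_range _).bddAbove _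

/-- The moment generating function factors into that of ΔX₁, which takes values in [0, 2Δ], and that
of the standard Gaussian. This holds for every `p`, hence the uniformity of the theorem in `p`. -/
theorem isSubGaussianBetween_rewardLaw {Δ : ℝ} (hΔ : 0 ≤ Δ) (p : Fin N → unitInterval)
    (a : Intervention N) : IsSubGaussianBetween (2 * Δ) (rewardLaw Δ p a) := by
  have hexp : ∀ s : ℝ, (fun z : (Fin N → Fin 2) × ℝ => Real.exp (s * (Δ * value (z.1 0) + z.2))) =
      fun z => Real.exp (s * (Δ * value (z.1 0))) * Real.exp (s * z.2) := by
    intro s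
    ext z
    rw [← Real.exp_add, mul_add]
  have hint : ∀ s : ℝ, Integrable
      (fun z : Fin N → Fin 2 => Real.exp (s * (Δ * value (z 0)))) (doLaw p a) :=
    fun s => Integrable.of_finite
  have heq : ∀ s : ℝ, ∫ y, Real.exp (s * y) ∂(rewardLaw Δ p a) =
      (∫ z, Real.exp (s * (Δ * value (z 0))) ∂(doLaw p a)) * Real.exp (s ^ 2 / 2) := by
    intro s
    rw [rewardLaw, integral_map (measurable_reward Δ).aemeasurable (by fun_prop), hexp,
      integral_prod_mul (fun z : Fin N → Fin 2 => Real.exp (s * (Δ * value (z 0))))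
        (fun x : ℝ => Real.exp (s * x))]
    congr 1
    have h := congrFun (mgf_id_gaussianReal (μ := 0) (v := 1)) s
    simpa [mgf] using h
  have hle : ∀ s b : ℝ, (∀ v, s * (Δ * value v) ≤ b) →
      ∫ y, Real.exp (s * y) ∂(rewardLaw Δ p a) ≤ Real.exp (b + s ^ 2 / 2) := by
    intro s b hb
    rw [heq, Real.exp_add]
    gcongr
    calc _ ≤ ∫ _z, Real.exp b ∂(doLaw p a) :=
          integral_mono (hint s) (integrable_const _) fun z => Real.exp_le_exp.2 (hb _)
      _ = _ := by simp
  refine ⟨fun s => ?_, fun s hs => ?_, fun s hs => ?_⟩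
  · rw [rewardLaw, integrable_map_measure (by fun_prop) (measurable_reward Δ).aemeasurable]
    simp only [Function.comp_def, hexp]
    exact (hint s).mul_prod (integrable_exp_mul_gaussianReal s)
  · refine hle s _ fun v => mul_le_mul_of_nonneg_left ?_ hs
    nlinarith [value_le_two v]
  · refine (hle (-s) 0 fun v => ?_).trans_eq (by simp)
    have : 0 ≤ s * (Δ * value v) :=
      mul_nonneg hs (mul_nonneg hΔ (zero_le_one.trans (one_le_value v)))
    linarith

theorem three_mul_card_filter_eq (o : Option (Fin 2)) :
    3 * (Finset.univ.filter fun a : Intervention N => a 0 = o).card = 3 ^ N := by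
  have h : (Finset.univ.filter fun a : Intervention N => a 0 = o) =
      Fintype.piFinset fun i => if i = 0 then {o} else Finset.univ := by
    ext a
    simp only [Finset.mem_filter, Finset.mem_univ, true_and, Fintype.mem_piFinset]
    constructor
    · intro ha i
      split_ifs with hi
      · simp [hi, ha]
      · simp
    · intro ha
      simpa using ha 0
  rw [h, Fintype.card_piFinset, ← Finset.mul_prod_erase Finset.univ _ (Finset.mem_univ 0)]
  have h2 : ∀ i ∈ Finset.univ.erase (0 : Fin N),
      (if i = 0 then ({o} : Finset (Option (Fin 2))) else Finset.univ).card = 3 := by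
    intro i hi
    rw [if_neg (Finset.ne_of_mem_erase hi)]
    simp
  rw [Finset.prod_congr rfl h2, Finset.prod_const, Finset.card_erase_of_mem (Finset.mem_univ _)]
  simp only [if_true, Finset.card_singleton, one_mul, Finset.card_univ, Fintype.card_fin]
  rw [← pow_succ', Nat.sub_add_cancel (NeZero.one_le)]

end Law

/-! ### From pull counts to regret -/

section Regret

variable {Ω : Type*} [MeasurableSpace Ω] {P : Measure Ω}

theorem expectedRegret_eq_integral [IsProbabilityMeasure P] {K : Type*} [Finite K]
    {A : ℕ → Ω → K} (hA : ∀ t a, MeasurableSet (A t ⁻¹' {a})) (mean : K → ℝ) (T : ℕ) :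
    Integrable (fun ω => ∑ t ∈ Finset.range T, ((⨆ a, mean a) - mean (A t ω))) P ∧
      expectedRegret P mean A T =
        ∫ ω, ∑ t ∈ Finset.range T, ((⨆ a, mean a) - mean (A t ω)) ∂P := by
  let _ : MeasurableSpace K := ⊤
  have hmeas : ∀ t, Measurable (A t) := fun t => measurable_to_countable' (hA t)
  have hint : ∀ t, Integrable (fun ω => mean (A t ω)) P := by
    intro t
    obtain ⟨C, hC⟩ := (Set.finite_range fun a => ‖mean a‖).bddAbove
    refine Integrable.of_bound ((measurable_of_finite mean).comp (hmeas t)).aestronglyMeasurable C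
      (Filter.Eventually.of_forall fun ω => hC ⟨A t ω, rfl⟩)
  have hint' : ∀ t ∈ Finset.range T, Integrable (fun ω => (⨆ a, mean a) - mean (A t ω)) P :=
    fun t _ => (integrable_const _).sub (hint t)
  refine ⟨integrable_finsetSum _ hint', ?_⟩
  rw [integral_finsetSum _ hint', expectedRegret]
  simp_rw [fun t => integral_sub (integrable_const (⨆ a, mean a)) (hint t)]
  simp

/-- If, with probability at least `q`, each of the arms of a set `S` of arms with gap at least
`Δ` is pulled at least `m` times, then the regret is at least `q * Δ * (card S * m)`. -/
theorem le_expectedRegret [IsProbabilityMeasure P] {K : Type*} [Finite K] [DecidableEq K]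
    {A : ℕ → Ω → K} (hA : ∀ t a, MeasurableSet (A t ⁻¹' {a})) {mean : K → ℝ} {T : ℕ}
    {S : Finset K} {Δ m q : ℝ} (hΔ : 0 ≤ Δ) (hm : 0 ≤ m)
    (hS : ∀ a ∈ S, Δ ≤ (⨆ a, mean a) - mean a)
    (hq : q ≤ P.real {ω | ∀ b, m ≤ pulls (fun t => A t ω) T b}) :
    q * (Δ * (S.card * m)) ≤ expectedRegret P mean A T := by
  obtain ⟨hint, heq⟩ := expectedRegret_eq_integral (P := P) hA mean T
  have hgap : ∀ a, 0 ≤ (⨆ a, mean a) - mean a := fun a =>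
    sub_nonneg.2 (le_ciSup (Set.finite_range mean).bddAbove a)
  rw [heq]
  -- Markov's inequality for the pathwise regret, which is nonnegative; grouping rounds by arm shows
  -- that it reaches the threshold on the good event.
  have hmarkov := mul_meas_ge_le_integral_of_nonneg (μ := P)
    (Filter.Eventually.of_forall fun ω => Finset.sum_nonneg fun t _ => hgap (A t ω)) hint
    (Δ * (S.card * m))
  refine le_trans ?_ hmarkov
  rw [mul_comm]
  refine mul_le_mul_of_nonneg_left (hq.trans (measureReal_mono ?_)) (by positivity)
  intro ω hω
  simp only [Set.mem_ofPred_eq] at hω ⊢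
  calc Δ * (S.card * m) = ∑ _a ∈ S, Δ * m := by
        rw [Finset.sum_const, nsmul_eq_mul]
        ring
    _ ≤ ∑ a ∈ S, Δ * pulls (fun t => A t ω) T a :=
        Finset.sum_le_sum fun a _ => mul_le_mul_of_nonneg_left (hω a) hΔ
    _ ≤ ∑ a ∈ S, ∑ t ∈ (Finset.range T).filter fun t => A t ω = a,
          ((⨆ a, mean a) - mean (A t ω)) := by
        refine Finset.sum_le_sum fun a ha => ?_
        rw [mul_comm, pulls, ← nsmul_eq_mul]
        refine Finset.card_nsmul_le_sum _ _ _ fun t ht => ?_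
        rw [(Finset.mem_filter.1 ht).2]
        exact hS a ha
    _ = ∑ t ∈ (Finset.range T).filter fun t => A t ω ∈ S,
          ((⨆ a, mean a) - mean (A t ω)) := by
        rw [← Finset.sum_fiberwise_of_maps_to (s := (Finset.range T).filter fun t => A t ω ∈ S)
          (t := S) (g := fun t => A t ω) fun t ht => (Finset.mem_filter.1 ht).2]
        refine Finset.sum_congr rfl fun a ha => Finset.sum_congr ?_ fun _ _ => rfl
        ext t
        simp only [Finset.mem_filter, and_assoc]
        constructor
        · rintro ⟨h1, h2⟩
          exact ⟨h1, h2 ▸ ha, h2⟩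
        · rintro ⟨h1, _, h2⟩
          exact ⟨h1, h2⟩
    _ ≤ _ := Finset.sum_le_sum_of_subset_of_nonneg (Finset.filter_subset _ _)
        fun t _ _ => hgap (A t ω)

end Regret

/-! ### The lower bound for short and for long horizons -/

section LowerBound

theorem card_intervention (N : ℕ) : Fintype.card (Intervention N) = 3 ^ N := by
  simp

variable {Ω : Type*} [MeasurableSpace Ω] {P : Measure Ω} [IsProbabilityMeasure P]
  {N : ℕ} [NeZero N] {Δ : ℝ} {p : Fin N → unitInterval} {v : UCBVersion} {T : ℕ}
  {Y : Intervention N → ℕ → Ω → ℝ} {A : ℕ → Ω → Intervention N}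

/-- A third of the arms has gap `Δ`. -/
theorem le_expectedRegret_armMean (hA : ∀ t a, MeasurableSet (A t ⁻¹' {a})) (hΔ : 0 ≤ Δ)
    {m q : ℝ} (hm : 0 ≤ m) (hq : q ≤ P.real {ω | ∀ b, m ≤ pulls (fun t => A t ω) T b}) :
    q * (Δ * ((3 : ℝ) ^ N / 3 * m)) ≤ expectedRegret P (armMean Δ p) A T := by
  have h := le_expectedRegret (P := P) hA (mean := armMean Δ p)
    (S := Finset.univ.filter fun a : Intervention N => a 0 = some 0) hΔ hm (fun a ha => by
      rw [iSup_armMean hΔ, armMean_of_eq_some Δ p (Finset.mem_filter.1 ha).2]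
      simp only [value, Fin.val_zero, Nat.cast_zero]
      linarith) hq
  have hcard := three_mul_card_filter_eq (N := N) (some 0)
  have hcard' : (3 : ℝ) * (Finset.univ.filter fun a : Intervention N => a 0 = some 0).card =
      3 ^ N := by exact_mod_cast hcard
  rwa [← hcard', mul_div_cancel_left₀ _ (by norm_num : (3 : ℝ) ≠ 0)]

theorem initial_le_expectedRegret (hA : ∀ t a, MeasurableSet (A t ⁻¹' {a})) (hΔ : 0 ≤ Δ)
    (hT : 3 ^ N ≤ T)
    (hrun : ∀ᵐ ω ∂P, IsUCBRun v T (fun a n => Y a n ω) (fun t => A t ω)) :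
    Δ * ((3 : ℝ) ^ N / 3) ≤ expectedRegret P (armMean Δ p) A T := by
  have hq : (1 : ℝ) ≤ P.real {ω | ∀ b, (1 : ℝ) ≤ pulls (fun t => A t ω) T b} := by
    refine ((probReal_univ (μ := P)).symm.trans (measureReal_congr ?_)).le
    filter_upwards [hrun] with ω hω
    refine (eq_true ?_).symm
    intro b
    exact_mod_cast hω.one_le_pulls ((card_intervention N).trans_le hT) b
  simpa using le_expectedRegret_armMean (p := p) hA hΔ zero_le_one hq

theorem long_horizon_le_expectedRegret {ε : ℝ} (hε : 0 < ε) (hε1 : ε ≤ 1)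
    (hTε : 1024 / ε ^ 2 ≤ (T : ℝ) ^ ε) (hK : (3 : ℝ) ^ N ≤ (T : ℝ) ^ (1 - ε))
    (hΔ : 2 * Δ = Real.sqrt (3 ^ N / T))
    (hY : IsRewardTable P (rewardLaw Δ p) Y) (hA : ∀ t a, MeasurableSet (A t ⁻¹' {a}))
    (hrun : ∀ᵐ ω ∂P, IsUCBRun v T (fun a n => Y a n ω) (fun t => A t ω)) :
    1 / 6 * Δ * (T : ℝ) ^ (1 - ε) ≤ expectedRegret P (armMean Δ p) A T := by
  set K : ℝ := (3 : ℝ) ^ N with hKdef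
  have hKpos : 0 < K := by positivity
  have hΔ0 : 0 ≤ Δ := by
    have := Real.sqrt_nonneg (K / T)
    linarith
  have h1024 : (1024 : ℝ) ≤ (T : ℝ) ^ ε := by
    refine le_trans ?_ hTε
    rw [le_div_iff₀ (by positivity)]
    nlinarith
  have hTpos : (0 : ℝ) < T := by
    rcases (Nat.cast_nonneg (α := ℝ) T).eq_or_lt with h | h
    · rw [← h, Real.zero_rpow hε.ne'] at h1024
      norm_num at h1024
    · exact h
  have hT1 : (1 : ℝ) ≤ T := by exact_mod_cast Nat.cast_pos.1 hTpos
  have hsplit : (T : ℝ) ^ (1 - ε) * (T : ℝ) ^ ε = T := by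
    rw [← Real.rpow_add hTpos]
    simp
  have hpow : (0 : ℝ) < (T : ℝ) ^ (1 - ε) := by positivity
  have hKT : 1024 * K ≤ T := by nlinarith
  have hK1 : 1 ≤ K := one_le_pow₀ (by norm_num)
  have hcard : (Fintype.card (Intervention N) : ℝ) = K := by
    rw [card_intervention]
    push_cast
    rfl
  have hlog2 : 0 < Real.log 2 := Real.log_pos (by norm_num)
  have hlog2' : 1 / 2 < Real.log 2 := by linarith [Real.log_two_gt_d9]
  have hlogε : 10 * Real.log 2 ≤ ε * Real.log T := by
    have h := Real.log_le_log (by norm_num) h1024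
    rw [Real.log_rpow hTpos] at h
    have e : Real.log 1024 = 10 * Real.log 2 := by
      rw [show (1024 : ℝ) = 2 ^ 10 by norm_num, Real.log_pow]
      norm_num
    linarith
  have hlogT : 0 ≤ Real.log T := Real.log_nonneg hT1
  have hlogT' : 10 * Real.log 2 ≤ Real.log T := by nlinarith
  have hhalf : Real.log ((T : ℝ) / 2) = Real.log T - Real.log 2 :=
    Real.log_div hTpos.ne' (by norm_num)
  have hquarter : Real.exp (-2 * Real.log 2) = 1 / 4 := by
    rw [show -2 * Real.log 2 = Real.log (2 ^ (-2 : ℤ)) by rw [Real.log_zpow]; norm_num,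
      Real.exp_log (by norm_num)]
    norm_num
  -- With this n₀ one has 2Δ√n₀ = 1/2, and K(n₀ + 1) = T/4 + K stays below half the horizon. The
  -- condition 16m ≤ κ²n₀ becomes 1024 T^(1-ε) ≤ ε²T, the source of the constant 1024.
  have hprob := half_le_measureReal_lt_pulls (κ := ε / 4) (m := (T : ℝ) ^ (1 - ε) / K)
    (n₀ := T / (4 * K)) hY (isSubGaussianBetween_rewardLaw hΔ0 p) hrun
    (by positivity) (by linarith) (by positivity) (by positivity)
    (by
      rw [hΔ, ← Real.sqrt_mul (by positivity), Real.sqrt_le_one]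
      field_simp
      norm_num)
    (by
      rw [div_le_iff₀ (by positivity)] at hTε
      have e : 1024 * (T : ℝ) ^ (1 - ε) ≤ ε ^ 2 * T := by
        calc _ ≤ (T : ℝ) ^ ε * ε ^ 2 * (T : ℝ) ^ (1 - ε) := by gcongr
          _ = ε ^ 2 * ((T : ℝ) ^ (1 - ε) * (T : ℝ) ^ ε) := by ring
          _ = _ := by rw [hsplit]
      have e2 : (ε / 4) ^ 2 * (T / (4 * K)) - 16 * ((T : ℝ) ^ (1 - ε) / K) =
          (ε ^ 2 * T - 1024 * (T : ℝ) ^ (1 - ε)) / (64 * K) := by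
        field_simp
        ring
      have e3 : 0 ≤ (ε ^ 2 * T - 1024 * (T : ℝ) ^ (1 - ε)) / (64 * K) :=
        div_nonneg (by linarith) (by positivity)
      linarith)
    (by rw [hhalf]; linarith)
    (by
      rw [hcard]
      have e : K * (T / (4 * K) + 1) = T / 4 + K := by field_simp
      linarith)
    (by
      rw [hcard, mul_div_cancel₀ _ hKpos.ne', Real.rpow_def_of_pos hTpos, ← Real.exp_add,
        ← hquarter, hhalf]
      refine Real.exp_le_exp.2 ?_
      -- Then the exponent is at most -(ε/2) log T + log 2, and `hlogε` bounds this by -4 log 2.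
      have e1 : (1 - ε / 2) * (Real.log T - Real.log 2) ≤
          (1 - ε / 4) ^ 2 * (Real.log T - Real.log 2) := by
        refine mul_le_mul_of_nonneg_right ?_ (by linarith)
        nlinarith [sq_nonneg ε]
      nlinarith)
    (by
      rw [hcard]
      calc K * T * Real.exp (-4 * Real.log ((T : ℝ) / 2))
          ≤ T * T * Real.exp (-4 * Real.log ((T : ℝ) / 2)) := by
            gcongr
            linarith
        _ = Real.exp (Real.log T + Real.log T + -4 * Real.log ((T : ℝ) / 2)) := by
            rw [Real.exp_add, Real.exp_add, Real.exp_log hTpos]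
        _ ≤ Real.exp (-2 * Real.log 2) := by
            rw [hhalf]
            refine Real.exp_le_exp.2 ?_
            linarith
        _ = 1 / 4 := hquarter)
  have hprob' : (1 : ℝ) / 2 ≤
      P.real {ω | ∀ b, (T : ℝ) ^ (1 - ε) / K ≤ pulls (fun t => A t ω) T b} :=
    hprob.trans (measureReal_mono fun ω hω b => (hω b).le)
  refine le_trans (le_of_eq ?_)
    (le_expectedRegret_armMean (p := p) hA hΔ0 (by positivity) hprob')
  rw [← hKdef]
  field_simp
  ring

theorem exists_const_le_expectedRegret {ε : ℝ} (hε : 0 < ε) (hε1 : ε ≤ 1) :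
    ∃ C : ℝ, 0 < C ∧
      ∀ (N : ℕ) [NeZero N] (T : ℕ), 3 ^ N ≤ T →
        ∃ Δ : ℝ, 0 < Δ ∧ 2 * Δ ≤ 1 ∧
          ∀ (p : Fin N → unitInterval) (v : UCBVersion)
            (Ω : Type*) [MeasurableSpace Ω] (P : Measure Ω) [IsProbabilityMeasure P]
            (Y : Intervention N → ℕ → Ω → ℝ) (A : ℕ → Ω → Intervention N),
            IsRewardTable P (rewardLaw Δ p) Y →
            (∀ t a, MeasurableSet (A t ⁻¹' {a})) →
            (∀ᵐ ω ∂P, IsUCBRun v T (fun a n => Y a n ω) (fun t => A t ω)) →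
            C * Real.sqrt (3 ^ N) * (T : ℝ) ^ (1 / 2 - ε) ≤
              expectedRegret P (armMean Δ p) A T := by
  -- Chosen so that T ≥ T₀ gives T^ε ≥ 1024/ε².
  set T₀ : ℝ := (1024 / ε ^ 2) ^ (1 / ε) with hT₀
  have hbase : (1 : ℝ) ≤ 1024 / ε ^ 2 := by
    rw [le_div_iff₀ (by positivity)]
    nlinarith
  have hT₀1 : 1 ≤ T₀ := Real.one_le_rpow hbase (by positivity)
  refine ⟨1 / (12 * T₀), by positivity, fun N _ T hT => ?_⟩
  have hKT : (3 : ℝ) ^ N ≤ T := by exact_mod_cast hT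
  have hKpos : (0 : ℝ) < 3 ^ N := by positivity
  have hK1 : (1 : ℝ) ≤ 3 ^ N := one_le_pow₀ (by norm_num)
  have hTpos : (0 : ℝ) < T := hKpos.trans_le hKT
  refine ⟨Real.sqrt (3 ^ N / T) / 2, by positivity, ?_, ?_⟩
  · rw [mul_div_cancel₀ _ two_ne_zero, Real.sqrt_le_one]
    exact div_le_one_of_le₀ hKT hTpos.le
  intro p v Ω _ P _ Y A hY hA hrun
  have hpow : (T : ℝ) ^ (1 / 2 - ε) = (T : ℝ) ^ (1 - ε) / Real.sqrt T := by
    rw [Real.sqrt_eq_rpow, ← Real.rpow_sub hTpos]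
    ring_nf
  have hsqrt : Real.sqrt ((3 : ℝ) ^ N / T) = Real.sqrt (3 ^ N) / Real.sqrt T :=
    Real.sqrt_div' _ hTpos.le
  -- Above this threshold both T ≥ T₀ and 3^N ≤ T^(1-ε) follow; below it the initial regret Δ 3^N/3
  -- suffices, at the price of the factor T₀ in the constant.
  rcases le_or_gt ((T : ℝ) ^ (1 - ε)) (T₀ * 3 ^ N) with hshort | hlong
  · refine le_trans ?_ (initial_le_expectedRegret (p := p) hA (by positivity) hT hrun)
    rw [hpow, hsqrt]
    calc 1 / (12 * T₀) * Real.sqrt (3 ^ N) * ((T : ℝ) ^ (1 - ε) / Real.sqrt T)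
        ≤ 1 / (12 * T₀) * Real.sqrt (3 ^ N) * (2 * (T₀ * 3 ^ N) / Real.sqrt T) := by
          gcongr
          linarith [mul_pos (zero_lt_one.trans_le hT₀1) hKpos]
      _ = _ := by
          field_simp
          norm_num
  · have h1 : (3 : ℝ) ^ N ≤ (T : ℝ) ^ (1 - ε) := by nlinarith
    have hT1 : (1 : ℝ) ≤ T := hK1.trans hKT
    have h2 : T₀ ≤ T := by
      calc T₀ ≤ T₀ * 3 ^ N := le_mul_of_one_le_right (by linarith) hK1
        _ ≤ (T : ℝ) ^ (1 - ε) := hlong.le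
        _ ≤ (T : ℝ) ^ (1 : ℝ) := Real.rpow_le_rpow_of_exponent_le hT1 (by linarith)
        _ = T := Real.rpow_one _
    have h3 : 1024 / ε ^ 2 ≤ (T : ℝ) ^ ε := by
      calc 1024 / ε ^ 2 = T₀ ^ ε := by
            rw [hT₀, ← Real.rpow_mul (by positivity), one_div_mul_cancel hε.ne', Real.rpow_one]
        _ ≤ (T : ℝ) ^ ε := Real.rpow_le_rpow (by linarith) h2 hε.le
    refine le_trans ?_ (long_horizon_le_expectedRegret (p := p) hε hε1 h3 h1
      (mul_div_cancel₀ _ two_ne_zero) hY hA hrun)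
    rw [hpow, hsqrt]
    calc 1 / (12 * T₀) * Real.sqrt (3 ^ N) * ((T : ℝ) ^ (1 - ε) / Real.sqrt T)
        ≤ 1 / 12 * Real.sqrt (3 ^ N) * ((T : ℝ) ^ (1 - ε) / Real.sqrt T) := by
          gcongr
          linarith
      _ = _ := by ring

end LowerBound

end CausalBandit

theorem theorem4 (ε : ℝ) (hε : 0 < ε) :
    ∃ C : ℝ, 0 < C ∧
      ∀ (N : ℕ) [NeZero N] (T : ℕ), 3 ^ N ≤ T →
        ∃ Δ : ℝ, 0 < Δ ∧ 2 * Δ ≤ 1 ∧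
          ∀ (p : Fin N → unitInterval) (v : CausalBandit.UCBVersion)
            (Ω : Type*) [MeasurableSpace Ω] (P : Measure Ω) [IsProbabilityMeasure P]
            (Y : CausalBandit.Intervention N → ℕ → Ω → ℝ)
            (A : ℕ → Ω → CausalBandit.Intervention N),
            CausalBandit.IsRewardTable P (CausalBandit.rewardLaw Δ p) Y →
            (∀ t a, MeasurableSet (A t ⁻¹' {a})) →
            (∀ᵐ ω ∂P, CausalBandit.IsUCBRun v T (fun a n => Y a n ω) (fun t => A t ω)) →
            C * Real.sqrt (3 ^ N) * (T : ℝ) ^ (1 / 2 - ε) ≤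
              CausalBandit.expectedRegret P (CausalBandit.armMean Δ p) A T := by
  -- Capping ε at 1 is harmless: as T ≥ 1, a smaller ε gives a stronger bound.
  obtain ⟨C, hC, h⟩ := CausalBandit.exists_const_le_expectedRegret
    (lt_min hε one_pos) (min_le_right ε 1)
  refine ⟨C, hC, fun N _ T hT => ?_⟩
  obtain ⟨Δ, hΔ, hΔ1, hreg⟩ := h N T hT
  refine ⟨Δ, hΔ, hΔ1, fun p v Ω _ P _ Y A hY hA hrun => ?_⟩
  refine le_trans ?_ (hreg p v Ω P Y A hY hA hrun)
  have hT1 : (1 : ℝ) ≤ T := by exact_mod_cast (Nat.one_le_pow N 3 (by norm_num)).trans hT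
  gcongr
  exact min_le_left ε 1
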